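/- Let $p$ be a prime, $n\ge 1$, let $F_n$ be the free group with basis $x_1,\ldots,x_n$, and let $F(n)$ be the free pro-$p$ group with generators $x_1,\ldots,x_n$, i.e. the inverse limit of the quotients of $F_n$ by its normal subgroups of $p$-power index. For a pro-$p$ group $G$ let $\mathbf Z_p[[G]]=\varprojlim \mathbf Z_p[G/U]$ ($U$ running over the open normal subgroups of $G$) be its completed group algebra, with the inverse limit topology. Let $D_n:\mathbf Z[F_n]\to\mathbf Z[F_n]$ be the Fox derivative with respect to $x_n$, i.e. the additive map with $D_n(uv)=D_n(u)v+\varepsilon(u)D_n(v)$ ($\varepsilon$ the augmentation), $D_n(x_n)=1$, and $D_n(x_j)=0$ for $j\ne n$, and let $\partial_n:\mathbf Z_p[[F(n)]]\to\mathbf Z_p[[F(n)]]$ be its continuous extension. Let $H$ be the closed subgroup of $F(n)$ generated by $x_1,\ldots,x_{n-1}$ (the free pro-$p$ group on these generators), let $1\neq r\in F(n)$, let $R$ be the closed normal subgroup of $F(n)$ generated by $r$, and let $\pi:\mathbf Z_p[[F(n)]]\to\mathbf Z_p[[F(n)/R]]$ be the homomorphism induced by the natural homomorphism $F(n)\to F(n)/R$.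 If $H\cap R=1$, then $\pi(\partial_n(r))\neq 0$. -/

import Mathlib

noncomputable section

open Filter Topology

namespace ProPFox

section ProPCompletion

/-- The normal subgroups of `G` whose index is a power of `p`. -/
def PPowerNormal (p : ℕ) (G : Type*) [Group G] : Type _ :=
  {N : Subgroup G // N.Normal ∧ ∃ k : ℕ, N.index = p ^ k}

instance PPowerNormal.normal {p : ℕ} {G : Type*} [Group G] (N : PPowerNormal p G) :
    N.1.Normal := N.2.1

/-- The compatible families in the product of all quotients `G ⧸ N`, where `N` runs through the
normal subgroups of `p`-power index. -/
def proPSubgroup (p : ℕ) (G : Type*) [Group G] :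
    Subgroup (∀ N : PPowerNormal p G, G ⧸ N.1) where
  carrier := {x | ∀ (N M : PPowerNormal p G) (h : N.1 ≤ M.1),
    QuotientGroup.map N.1 M.1 (MonoidHom.id G) h (x N) = x M}
  one_mem' := fun N M h => by simp
  mul_mem' := fun {x y} hx hy N M h => by
    simp only [Pi.mul_apply, map_mul]; rw [hx N M h, hy N M h]
  inv_mem' := fun {x} hx N M h => by
    simp only [Pi.inv_apply, map_inv]; rw [hx N M h]

/-- The pro-`p` completion of the (discrete) group `G`: the inverse limit of the quotients
`G ⧸ N`, where `N` runs through the normal subgroups of `p`-power index. -/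
def ProPCompletion (p : ℕ) (G : Type*) [Group G] : Type _ := proPSubgroup p G

variable {p : ℕ} {G : Type*} [Group G]

instance : Group (ProPCompletion p G) := inferInstanceAs (Group (proPSubgroup p G))

/-- The inverse limit topology, each quotient `G ⧸ N` being discrete. -/
instance : TopologicalSpace (ProPCompletion p G) :=
  TopologicalSpace.induced (fun x => x.1)
    (@Pi.topologicalSpace (PPowerNormal p G) (fun N => G ⧸ N.1) (fun _ => ⊥))

/-- The projection of the pro-`p` completion onto `G ⧸ N`. -/
def ProPCompletion.proj (N : PPowerNormal p G) : ProPCompletion p G →* G ⧸ N.1 :=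
  (Pi.evalMonoidHom _ N).comp (proPSubgroup p G).subtype

/-- The canonical homomorphism from `G` to its pro-`p` completion. -/
def ProPCompletion.eta (p : ℕ) (G : Type*) [Group G] : G →* ProPCompletion p G where
  toFun g := ⟨fun N => QuotientGroup.mk' N.1 g, fun _ _ _ => rfl⟩
  map_one' := rfl
  map_mul' _ _ := rfl

theorem ProPCompletion.continuous_proj [Fact p.Prime] (N : PPowerNormal p G) :
    @Continuous _ _ _ ⊥ (ProPCompletion.proj (p := p) N) := by
  let _ : ∀ N : PPowerNormal p G, TopologicalSpace (G ⧸ N.1) := fun _ => ⊥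
  exact (continuous_apply N).comp continuous_induced_dom

theorem ProPCompletion.isOpen_ker_proj [Fact p.Prime] (N : PPowerNormal p G) :
    IsOpen ((ProPCompletion.proj N).ker : Set (ProPCompletion p G)) := by
  let _ : TopologicalSpace (G ⧸ N.1) := ⊥
  have : DiscreteTopology (G ⧸ N.1) := ⟨rfl⟩
  exact (isOpen_discrete ({1} : Set (G ⧸ N.1))).preimage (continuous_proj N)

instance : IsTopologicalGroup (ProPCompletion p G) := by
  let _ : ∀ N : PPowerNormal p G, TopologicalSpace (G ⧸ N.1) := fun _ => ⊥
  have : ∀ N : PPowerNormal p G, DiscreteTopology (G ⧸ N.1) := fun _ => ⟨rfl⟩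
  exact inferInstanceAs (IsTopologicalGroup (proPSubgroup p G))

instance [Fact p.Prime] : CompactSpace (ProPCompletion p G) := by
  let _ : ∀ N : PPowerNormal p G, TopologicalSpace (G ⧸ N.1) := fun _ => ⊥
  have : ∀ N : PPowerNormal p G, DiscreteTopology (G ⧸ N.1) := fun _ => ⟨rfl⟩
  have : ∀ N : PPowerNormal p G, Finite (G ⧸ N.1) := fun N => by
    obtain ⟨k, hk⟩ := N.2.2
    have : N.1.FiniteIndex := ⟨by rw [hk]; exact pow_ne_zero _ (Fact.out : p.Prime).ne_zero⟩
    infer_instance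
  have hcl : IsClosed ((proPSubgroup p G : Subgroup _) : Set (∀ N : PPowerNormal p G, G ⧸ N.1)) := by
    have : ((proPSubgroup p G : Subgroup _) : Set (∀ N : PPowerNormal p G, G ⧸ N.1)) =
        ⋂ (N : PPowerNormal p G) (M : PPowerNormal p G) (h : N.1 ≤ M.1),
          {x | QuotientGroup.map N.1 M.1 (MonoidHom.id G) h (x N) = x M} := by
      ext x
      simp only [Set.mem_iInter]
      rfl
    rw [this]
    refine isClosed_iInter fun N => isClosed_iInter fun M => isClosed_iInter fun h => ?_
    exact isClosed_eq (continuous_of_discreteTopology.comp (continuous_apply N))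
      (continuous_apply M)
  exact isCompact_iff_compactSpace.mp hcl.isCompact

/-- Normal subgroups of `p`-power index form a directed family. -/
theorem PPowerNormal.exists_inf [Fact p.Prime] (N M : PPowerNormal p G) :
    ∃ L : PPowerNormal p G, L.1 ≤ N.1 ∧ L.1 ≤ M.1 := by
  obtain ⟨k, hk⟩ := N.2.2
  obtain ⟨l, hl⟩ := M.2.2
  refine ⟨⟨N.1 ⊓ M.1, inferInstance, ?_⟩, inf_le_left, inf_le_right⟩
  have h1 := Subgroup.relIndex_mul_index (inf_le_right : N.1 ⊓ M.1 ≤ M.1)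
  rw [Subgroup.inf_relIndex_right] at h1
  obtain ⟨m, -, hm⟩ := (Nat.dvd_prime_pow (Fact.out : p.Prime)).1
    (hk ▸ Subgroup.relIndex_dvd_index_of_normal N.1 M.1)
  exact ⟨m + l, by rw [← h1, hm, hl, pow_add]⟩

/-- The kernels of the projections are a basis of neighbourhoods of `1`. -/
theorem ProPCompletion.exists_ker_subset [Fact p.Prime] {W : Set (ProPCompletion p G)}
    (hW : W ∈ 𝓝 (1 : ProPCompletion p G)) :
    ∃ N : PPowerNormal p G, ((proj N).ker : Set (ProPCompletion p G)) ⊆ W := by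
  let _ : ∀ N : PPowerNormal p G, TopologicalSpace (G ⧸ N.1) := fun _ => ⊥
  have : ∀ N : PPowerNormal p G, DiscreteTopology (G ⧸ N.1) := fun _ => ⟨rfl⟩
  rw [nhds_induced, mem_comap] at hW
  obtain ⟨V, hV, hVW⟩ := hW
  rw [nhds_pi, Filter.mem_pi] at hV
  obtain ⟨I, hI, t, ht, htV⟩ := hV
  have key : ∃ L : PPowerNormal p G, ∀ N ∈ I, L.1 ≤ N.1 := by
    refine Set.Finite.induction_on (motive := fun I _ => ∃ L : PPowerNormal p G, ∀ N ∈ I, L.1 ≤ N.1)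
      I hI ⟨⟨⊤, inferInstance, 0, by simp⟩, by simp⟩ ?_
    rintro a s - - ⟨L, hL⟩
    obtain ⟨K, hK1, hK2⟩ := PPowerNormal.exists_inf a L
    refine ⟨K, fun N hN => ?_⟩
    rcases hN with rfl | hN
    · exact hK1
    · exact hK2.trans (hL N hN)
  obtain ⟨L, hL⟩ := key
  refine ⟨L, fun x hx => hVW (htV fun N hN => ?_)⟩
  have h1 : x.1 N = 1 := by
    rw [← x.2 L N (hL N hN)]
    have : x.1 L = 1 := hx
    rw [this, map_one]
  change x.1 N ∈ t N
  rw [h1]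
  exact mem_of_mem_nhds (ht N)

/-- The image of `G` in its pro-`p` completion meets every coset of an open subgroup. -/
theorem ProPCompletion.exists_eta_mem [Fact p.Prime] {U : Subgroup (ProPCompletion p G)}
    (hU : IsOpen (U : Set (ProPCompletion p G))) (x : ProPCompletion p G) :
    ∃ g : G, (eta p G g)⁻¹ * x ∈ U := by
  obtain ⟨N, hN⟩ := exists_ker_subset (hU.mem_nhds U.one_mem)
  obtain ⟨g, hg⟩ := QuotientGroup.mk_surjective (x.1 N)
  refine ⟨g, hN ?_⟩
  change proj N ((eta p G g)⁻¹ * x) = 1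
  rw [map_mul, map_inv, inv_mul_eq_one]
  exact hg

/-- The quotient of the pro-`p` completion by an open normal subgroup is a finite `p`-group. -/
theorem ProPCompletion.card_quotient [Fact p.Prime] (U : OpenNormalSubgroup (ProPCompletion p G)) :
    ∃ k : ℕ, Nat.card (ProPCompletion p G ⧸ U.toSubgroup) = p ^ k := by
  obtain ⟨N, hN⟩ := exists_ker_subset (U.isOpen'.mem_nhds U.toSubgroup.one_mem)
  obtain ⟨k, hk⟩ := N.2.2
  refine IsPGroup.iff_card.1 fun q => ?_
  obtain ⟨x, rfl⟩ := QuotientGroup.mk_surjective q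
  refine ⟨k, ?_⟩
  rw [← QuotientGroup.mk_pow, QuotientGroup.eq_one_iff]
  apply hN
  change proj N (x ^ p ^ k) = 1
  rw [map_pow, ← hk]
  exact pow_card_eq_one' (G := G ⧸ N.1)

end ProPCompletion

section CompletedGroupAlgebra

variable (p : ℕ) [Fact p.Prime] (G : Type*) [Group G] [TopologicalSpace G]

/-- The compatible families in the product of the group algebras `ℤ_p[G ⧸ U]`, where `U` runs
through the open normal subgroups of `G`. -/
def completedSubalgebra :
    Subalgebra ℤ_[p] (∀ U : OpenNormalSubgroup G, MonoidAlgebra ℤ_[p] (G ⧸ U.toSubgroup)) where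
  carrier := {a | ∀ (U V : OpenNormalSubgroup G) (h : U.toSubgroup ≤ V.toSubgroup),
    MonoidAlgebra.mapDomainAlgHom ℤ_[p] ℤ_[p]
      (QuotientGroup.map U.toSubgroup V.toSubgroup (MonoidHom.id G) h) (a U) = a V}
  mul_mem' := fun {a b} ha hb U V h => by
    simp only [Pi.mul_apply, map_mul]; rw [ha U V h, hb U V h]
  add_mem' := fun {a b} ha hb U V h => by
    simp only [Pi.add_apply, map_add]; rw [ha U V h, hb U V h]
  algebraMap_mem' := fun c U V h => by
    simp only [Pi.algebraMap_apply, AlgHom.commutes]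

/-- The completed group algebra `ℤ_p[[G]]`: the inverse limit of the group algebras `ℤ_p[G ⧸ U]`,
where `U` runs through the open normal subgroups of `G`. -/
def CompletedGroupAlgebra : Type _ := completedSubalgebra p G

instance : Ring (CompletedGroupAlgebra p G) := inferInstanceAs (Ring (completedSubalgebra p G))

instance : Algebra ℤ_[p] (CompletedGroupAlgebra p G) :=
  inferInstanceAs (Algebra ℤ_[p] (completedSubalgebra p G))

namespace CompletedGroupAlgebra

variable {G}

/-- The component of an element of `ℤ_p[[G]]` in `ℤ_p[G ⧸ U]`. -/
def proj (U : OpenNormalSubgroup G) :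
    CompletedGroupAlgebra p G →ₐ[ℤ_[p]] MonoidAlgebra ℤ_[p] (G ⧸ U.toSubgroup) :=
  (Pi.evalAlgHom ℤ_[p] _ U).comp (completedSubalgebra p G).val

/-- The canonical map from `G` to `ℤ_p[[G]]`. -/
def of : G →* CompletedGroupAlgebra p G where
  toFun g := ⟨fun U => MonoidAlgebra.of ℤ_[p] (G ⧸ U.toSubgroup) (QuotientGroup.mk' _ g),
    fun U V h => by simp; rfl⟩
  map_one' := Subtype.ext (funext fun U => by simp; rfl)
  map_mul' g h := Subtype.ext (funext fun U => by
    change _ = MonoidAlgebra.of ℤ_[p] (G ⧸ U.toSubgroup) _ * MonoidAlgebra.of ℤ_[p] _ _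
    simp)

/-- All coefficients of all components of an element of `ℤ_p[[G]]`. -/
def coeffs : CompletedGroupAlgebra p G →+
    ((U : OpenNormalSubgroup G) → G ⧸ U.toSubgroup → ℤ_[p]) where
  toFun a U q := (a.1 U).coeff q
  map_zero' := rfl
  map_add' _ _ := rfl

/-- The inverse limit topology (and uniformity), where each `ℤ_p[G ⧸ U]` carries the topology of
convergence of all coefficients in `ℤ_p`. -/
instance : UniformSpace (CompletedGroupAlgebra p G) :=
  UniformSpace.comap (coeffs p) inferInstance

variable {p}

theorem coeffs_injective : Function.Injective (coeffs p (G := G)) := fun _ _ h =>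
  Subtype.ext (funext fun U => MonoidAlgebra.coeff_injective (DFunLike.ext _ _ fun q =>
    congrFun (congrFun h U) q))

theorem isUniformInducing_coeffs : IsUniformInducing (coeffs p (G := G)) := ⟨rfl⟩

instance : T0Space (CompletedGroupAlgebra p G) :=
  (IsEmbedding.mk isUniformInducing_coeffs.isInducing coeffs_injective).t0Space

instance : IsUniformAddGroup (CompletedGroupAlgebra p G) :=
  IsUniformAddGroup.comap (coeffs p (G := G))

/-- Reduction modulo `p ^ m` of the component in `ℤ_p[G ⧸ U]`. -/
def red (U : OpenNormalSubgroup G) (m : ℕ) :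
    CompletedGroupAlgebra p G →+* MonoidAlgebra (ZMod (p ^ m)) (G ⧸ U.toSubgroup) :=
  (MonoidAlgebra.mapRingHom _ (PadicInt.toZModPow m)).comp (proj p U : _ →+* _)

theorem red_eq_zero_of_le {U V : OpenNormalSubgroup G} (h : U ≤ V) {m k : ℕ} (hk : k ≤ m)
    {a : CompletedGroupAlgebra p G} (ha : red U m a = 0) : red V k a = 0 := by
  have h1 : red U k a = 0 := by
    ext q
    have h2 := congrArg (fun x => MonoidAlgebra.coeff x q) ha
    simp only [red, RingHom.comp_apply, MonoidAlgebra.coeff_mapRingHom] at h2 ⊢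
    rw [← PadicInt.zmod_cast_comp_toZModPow k m hk, RingHom.comp_apply, h2]
    simp
  have h3 : red V k a = MonoidAlgebra.mapDomainRingHom (ZMod (p ^ k))
      (QuotientGroup.map U.toSubgroup V.toSubgroup (MonoidHom.id G) h) (red U k a) := by
    have := RingHom.congr_fun (MonoidAlgebra.mapRingHom_comp_mapDomainRingHom
      (PadicInt.toZModPow (p := p) k)
      (QuotientGroup.map U.toSubgroup V.toSubgroup (MonoidHom.id G) h)) (a.1 U)
    simp only [RingHom.comp_apply] at this
    exact (congrArg _ (a.2 U V h).symm).trans this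
  rw [h3, h1, map_zero]

/-- The ideals `ker (ℤ_p[[G]] → (ℤ / p ^ m)[G ⧸ U])` are arbitrarily small. -/
theorem exists_red_subset {W : Set (CompletedGroupAlgebra p G)}
    (hW : W ∈ 𝓝 (0 : CompletedGroupAlgebra p G)) :
    ∃ (U : OpenNormalSubgroup G) (m : ℕ), ∀ a, red U m a = 0 → a ∈ W := by
  rw [isUniformInducing_coeffs.isInducing.nhds_eq_comap, map_zero, mem_comap] at hW
  obtain ⟨T, hT, hTW⟩ := hW
  suffices h : ∃ (U : OpenNormalSubgroup G) (m : ℕ), ∀ a, red U m a = 0 → coeffs p a ∈ T by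
    obtain ⟨U, m, h⟩ := h
    exact ⟨U, m, fun a ha => hTW (h a ha)⟩
  have hdir : ∀ {U V : OpenNormalSubgroup G} {m k : ℕ}, ∃ (L : OpenNormalSubgroup G) (l : ℕ),
      ∀ a : CompletedGroupAlgebra p G, red L l a = 0 → red U m a = 0 ∧ red V k a = 0 :=
    fun {U V m k} => ⟨U ⊓ V, max m k, fun a ha =>
      ⟨red_eq_zero_of_le inf_le_left (le_max_left _ _) ha,
        red_eq_zero_of_le inf_le_right (le_max_right _ _) ha⟩⟩
  have htop : Nonempty (OpenNormalSubgroup G) :=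
    ⟨{ toOpenSubgroup := ⊤, isNormal' := inferInstanceAs (⊤ : Subgroup G).Normal }⟩
  obtain ⟨U₀⟩ := htop
  rw [nhds_pi, Filter.mem_pi] at hT
  obtain ⟨I, hI, t, ht, htT⟩ := hT
  suffices h : ∃ (U : OpenNormalSubgroup G) (m : ℕ), ∀ a, red U m a = 0 →
      ∀ V ∈ I, coeffs p a V ∈ t V by
    obtain ⟨U, m, h⟩ := h
    exact ⟨U, m, fun a ha => htT fun V hV => h a ha V hV⟩
  refine Set.Finite.induction_on (motive := fun I _ => ∃ (U : OpenNormalSubgroup G) (m : ℕ),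
    ∀ a, red U m a = 0 → ∀ V ∈ I, coeffs p a V ∈ t V) I hI ⟨U₀, 0, by simp⟩ ?_
  rintro V s - - ⟨L, l, hL⟩
  have hV : ∃ m : ℕ, ∀ a, red V m a = 0 → coeffs p a V ∈ t V := by
    have htV := ht V
    change t V ∈ 𝓝 (fun _ => (0 : ℤ_[p])) at htV
    rw [nhds_pi, Filter.mem_pi] at htV
    obtain ⟨J, hJ, s, hs, hst⟩ := htV
    have hq : ∀ q, ∃ m : ℕ, ∀ a, red V m a = 0 → coeffs p a V q ∈ s q := fun q => by
      obtain ⟨ε, hε, hball⟩ := Metric.mem_nhds_iff.1 (hs q)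
      obtain ⟨m, hm⟩ := PadicInt.exists_pow_neg_lt p hε
      refine ⟨m, fun a ha => hball ?_⟩
      rw [mem_ball_zero_iff]
      refine lt_of_le_of_lt ?_ hm
      rw [PadicInt.norm_le_pow_iff_mem_span_pow, ← PadicInt.ker_toZModPow, RingHom.mem_ker]
      have h2 := congrArg (fun x => MonoidAlgebra.coeff x q) ha
      simp only [red, RingHom.comp_apply, MonoidAlgebra.coeff_mapRingHom] at h2
      exact h2
    choose f hf using hq
    refine ⟨hJ.toFinset.sup f, fun a ha => hst fun q hq => hf q a
      (red_eq_zero_of_le le_rfl (Finset.le_sup (by simpa using hq)) ha)⟩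
  obtain ⟨m, hm⟩ := hV
  obtain ⟨K, k, hK⟩ := hdir (U := V) (V := L) (m := m) (k := l)
  refine ⟨K, k, fun a ha W hW => ?_⟩
  rcases hW with rfl | hW
  · exact hm a (hK a ha).1
  · exact hL a (hK a ha).2 W hW

/-- The ideals `ker (ℤ_p[[G]] → (ℤ / p ^ m)[G ⧸ U])` are open if `G ⧸ U` is finite. -/
theorem red_eq_zero_mem_nhds (U : OpenNormalSubgroup G) [Finite (G ⧸ U.toSubgroup)] (m : ℕ) :
    {a : CompletedGroupAlgebra p G | red U m a = 0} ∈ 𝓝 (0 : CompletedGroupAlgebra p G) := by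
  have hp : (0 : ℝ) < (p : ℝ) ^ (-m : ℤ) := zpow_pos (by exact_mod_cast (Fact.out : p.Prime).pos) _
  have h1 : ∀ q : G ⧸ U.toSubgroup, ∀ᶠ a in 𝓝 (0 : CompletedGroupAlgebra p G),
      ‖coeffs p a U q‖ < (p : ℝ) ^ (-m : ℤ) := fun q => by
    have hc : Continuous fun a : CompletedGroupAlgebra p G => ‖coeffs p a U q‖ :=
      ((continuous_apply q).comp ((continuous_apply U).comp
        isUniformInducing_coeffs.isInducing.continuous)).norm
    refine hc.continuousAt.eventually_lt continuousAt_const ?_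
    simpa using hp
  filter_upwards [eventually_all.2 h1] with a ha
  ext q
  have h2 := (ha q).le
  rw [PadicInt.norm_le_pow_iff_mem_span_pow, ← PadicInt.ker_toZModPow, RingHom.mem_ker] at h2
  simp only [red, RingHom.comp_apply, MonoidAlgebra.coeff_mapRingHom]
  exact h2

/-- `ℤ_p[[G]]` is complete if all `G ⧸ U` are finite. -/
theorem completeSpace (hfin : ∀ U : OpenNormalSubgroup G, Finite (G ⧸ U.toSubgroup)) :
    CompleteSpace (CompletedGroupAlgebra p G) := by
  rw [completeSpace_iff_isComplete_range (isUniformInducing_coeffs (p := p) (G := G))]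
  let E (U : OpenNormalSubgroup G) :
      (G ⧸ U.toSubgroup → ℤ_[p]) →ₗ[ℤ_[p]] MonoidAlgebra ℤ_[p] (G ⧸ U.toSubgroup) :=
    (MonoidAlgebra.coeffLinearEquiv ℤ_[p]).symm.toLinearMap ∘ₗ
      (Finsupp.linearEquivFunOnFinite ℤ_[p] ℤ_[p] (G ⧸ U.toSubgroup)).symm.toLinearMap
  have hE : ∀ U c q, (E U c).coeff q = c q := fun U c q => rfl
  have hE' : ∀ (U : OpenNormalSubgroup G) (a : MonoidAlgebra ℤ_[p] (G ⧸ U.toSubgroup)),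
      E U (fun q => a.coeff q) = a := fun U a => by ext q; rw [hE]
  let M (U V : OpenNormalSubgroup G) (h : U.toSubgroup ≤ V.toSubgroup) (q : G ⧸ V.toSubgroup) :
      (G ⧸ U.toSubgroup → ℤ_[p]) →ₗ[ℤ_[p]] ℤ_[p] :=
    Finsupp.lapply q ∘ₗ (MonoidAlgebra.coeffLinearEquiv ℤ_[p]).toLinearMap ∘ₗ
      (MonoidAlgebra.mapDomainAlgHom ℤ_[p] ℤ_[p]
        (QuotientGroup.map U.toSubgroup V.toSubgroup (MonoidHom.id G) h)).toLinearMap ∘ₗ E U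
  have hM : ∀ U V h q c, M U V h q c = (MonoidAlgebra.mapDomainAlgHom ℤ_[p] ℤ_[p]
        (QuotientGroup.map U.toSubgroup V.toSubgroup (MonoidHom.id G) h) (E U c)).coeff q :=
    fun _ _ _ _ _ => rfl
  have hr : Set.range (coeffs p (G := G)) = ⋂ (U : OpenNormalSubgroup G)
      (V : OpenNormalSubgroup G) (h : U.toSubgroup ≤ V.toSubgroup) (q : G ⧸ V.toSubgroup),
      {c | M U V h q (c U) = c V q} := by
    ext c
    simp only [Set.mem_iInter, Set.mem_ofPred_eq]
    constructor
    · rintro ⟨a, rfl⟩ U V h q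
      rw [hM]
      change (MonoidAlgebra.mapDomainAlgHom ℤ_[p] ℤ_[p] _
        (E U (fun q => (a.1 U).coeff q))).coeff q = (a.1 V).coeff q
      rw [hE', a.2 U V h]
    · intro hc
      refine ⟨⟨fun U => E U (c U), fun U V h => ?_⟩, ?_⟩
      · ext q
        rw [← hM, hc U V h q, hE]
      · rfl
  rw [hr]
  refine IsClosed.isComplete ?_
  refine isClosed_iInter fun U => isClosed_iInter fun V => isClosed_iInter fun h =>
    isClosed_iInter fun q => ?_
  exact isClosed_eq ((LinearMap.continuous_on_pi (M U V h q)).comp (continuous_apply U))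
    ((continuous_apply q).comp (continuous_apply V))

/-- The preimage of an open normal subgroup under a continuous homomorphism. -/
def comapOpenNormal {G' : Type*} [Group G'] [TopologicalSpace G'] (f : G →ₜ* G')
    (V : OpenNormalSubgroup G') : OpenNormalSubgroup G where
  toOpenSubgroup := V.toOpenSubgroup.comap (f : G →* G') f.continuous_toFun
  isNormal' := V.isNormal'.comap (f : G →* G')

variable (p) in
/-- The homomorphism `ℤ_p[[G]] → ℤ_p[[G']]` induced by a continuous homomorphism `f : G → G'`:
its component at `V` is the composition of the projection to `ℤ_p[G ⧸ f⁻¹(V)]` and of the map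
`ℤ_p[G ⧸ f⁻¹(V)] → ℤ_p[G' ⧸ V]` induced by `f`. -/
def map {G' : Type*} [Group G'] [TopologicalSpace G'] (f : G →ₜ* G') :
    CompletedGroupAlgebra p G →ₐ[ℤ_[p]] CompletedGroupAlgebra p G' :=
  AlgHom.codRestrict
    (AlgHom.pi fun V : OpenNormalSubgroup G' =>
      (MonoidAlgebra.mapDomainAlgHom ℤ_[p] ℤ_[p]
        (QuotientGroup.map (comapOpenNormal f V).toSubgroup V.toSubgroup (f : G →* G') le_rfl)).comp
        (proj p (comapOpenNormal f V)))
    (completedSubalgebra p G') (fun a U V h => by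
      have h1 := a.2 (comapOpenNormal f U) (comapOpenNormal f V) (Subgroup.comap_mono h)
      have h2 : (MonoidAlgebra.mapDomainAlgHom ℤ_[p] ℤ_[p]
          (QuotientGroup.map U.toSubgroup V.toSubgroup (MonoidHom.id G') h)).comp
          (MonoidAlgebra.mapDomainAlgHom ℤ_[p] ℤ_[p] (QuotientGroup.map
            (comapOpenNormal f U).toSubgroup U.toSubgroup (f : G →* G') le_rfl)) =
          (MonoidAlgebra.mapDomainAlgHom ℤ_[p] ℤ_[p] (QuotientGroup.map
            (comapOpenNormal f V).toSubgroup V.toSubgroup (f : G →* G') le_rfl)).comp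
          (MonoidAlgebra.mapDomainAlgHom ℤ_[p] ℤ_[p] (QuotientGroup.map
            (comapOpenNormal f U).toSubgroup (comapOpenNormal f V).toSubgroup (MonoidHom.id G)
            (Subgroup.comap_mono h))) := by
        rw [← MonoidAlgebra.mapDomainAlgHom_comp, ← MonoidAlgebra.mapDomainAlgHom_comp]
        congr 1
        ext x
        rfl
      exact (AlgHom.congr_fun h2 (a.1 (comapOpenNormal f U))).trans (congrArg
        (MonoidAlgebra.mapDomainAlgHom ℤ_[p] ℤ_[p] (QuotientGroup.map
          (comapOpenNormal f V).toSubgroup V.toSubgroup (f : G →* G') le_rfl)) h1))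

theorem map_of {G' : Type*} [Group G'] [TopologicalSpace G'] (f : G →ₜ* G') (g : G) :
    map p f (of p g) = of p (f g) :=
  Subtype.ext (funext fun V => by
    change MonoidAlgebra.mapDomainAlgHom ℤ_[p] ℤ_[p] _ (MonoidAlgebra.of _ _ _) =
      MonoidAlgebra.of _ _ _
    simp
    rfl)

end CompletedGroupAlgebra

end CompletedGroupAlgebra

section Fox

variable {n : ℕ}

/-- The Fox derivative with respect to `x_k` of the group element represented by a word in the
letters `(j, true) = x_j` and `(j, false) = x_j⁻¹`, computed by the rules `D(uv) = D(u)v + D(v)`,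
`D(x_j) = δ_{jk}`, `D(x_j⁻¹) = -δ_{jk} x_j⁻¹`. -/
def foxWord (k : Fin n) : List (Fin n × Bool) → MonoidAlgebra ℤ (FreeGroup (Fin n))
  | [] => 0
  | (j, b) :: L =>
    (if j = k then (if b then 1 else -MonoidAlgebra.of ℤ _ (FreeGroup.of j)⁻¹) else 0) *
      MonoidAlgebra.of ℤ _ (FreeGroup.mk L) + foxWord k L

theorem foxWord_append (k : Fin n) (L M : List (Fin n × Bool)) :
    foxWord k (L ++ M) =
      foxWord k L * MonoidAlgebra.of ℤ _ (FreeGroup.mk M) + foxWord k M := by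
  induction L with
  | nil => simp [foxWord]
  | cons a L ih =>
    obtain ⟨j, b⟩ := a
    simp only [List.cons_append, foxWord, ih, ← FreeGroup.mul_mk, map_mul]
    noncomm_ring

/-- The Fox derivative with respect to `x_k`, restricted to the free group. -/
def foxGroup (k : Fin n) : FreeGroup (Fin n) → MonoidAlgebra ℤ (FreeGroup (Fin n)) :=
  Quot.lift (foxWord k) (by
    rintro _ _ ⟨⟩
    rename_i L₁ L₂ x b
    have h : foxWord k ((x, b) :: (x, !b) :: L₂) = foxWord k L₂ := by
      have h1 : FreeGroup.mk ((x, true) :: L₂) = FreeGroup.of x * FreeGroup.mk L₂ := rfl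
      have h2 : FreeGroup.mk ((x, false) :: L₂) = (FreeGroup.of x)⁻¹ * FreeGroup.mk L₂ := rfl
      by_cases hx : x = k
      · subst hx
        cases b <;> simp [foxWord, h1, h2, MonoidAlgebra.single_mul_single]
      · simp [foxWord, hx]
    have h3 : FreeGroup.mk ((x, b) :: (x, !b) :: L₂) = FreeGroup.mk L₂ :=
      Quot.sound (FreeGroup.Red.Step.not (L₁ := []))
    rw [foxWord_append, foxWord_append, h, h3])

theorem foxGroup_mul (k : Fin n) (u v : FreeGroup (Fin n)) :
    foxGroup k (u * v) = foxGroup k u * MonoidAlgebra.of ℤ _ v + foxGroup k v := by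
  obtain ⟨L⟩ := u
  obtain ⟨M⟩ := v
  exact foxWord_append k L M

theorem foxGroup_of (k j : Fin n) :
    foxGroup k (FreeGroup.of j) = if j = k then 1 else 0 := by
  change foxWord k [(j, true)] = _
  have : FreeGroup.mk ([] : List (Fin n × Bool)) = 1 := rfl
  simp [foxWord, this, ← MonoidAlgebra.one_def]

theorem foxGroup_one (k : Fin n) : foxGroup k 1 = 0 := rfl

/-- The Fox derivative `D_k` of the integral group ring `ℤ[F_n]`. -/
def fox (k : Fin n) :
    MonoidAlgebra ℤ (FreeGroup (Fin n)) →ₗ[ℤ] MonoidAlgebra ℤ (FreeGroup (Fin n)) :=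
  Finsupp.linearCombination ℤ (foxGroup k) ∘ₗ (MonoidAlgebra.coeffLinearEquiv ℤ).toLinearMap

theorem fox_single (k : Fin n) (f : FreeGroup (Fin n)) (c : ℤ) :
    fox k (MonoidAlgebra.single f c) = c • foxGroup k f := by
  change Finsupp.linearCombination ℤ (foxGroup k) (MonoidAlgebra.single f c).coeff = _
  rw [MonoidAlgebra.coeff_single, Finsupp.linearCombination_single]

/-- The augmentation of `ℤ[F_n]`. -/
def augmentation (n : ℕ) : MonoidAlgebra ℤ (FreeGroup (Fin n)) →ₐ[ℤ] ℤ :=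
  MonoidAlgebra.lift ℤ ℤ _ 1

theorem fox_mul (k : Fin n) (u v : MonoidAlgebra ℤ (FreeGroup (Fin n))) :
    fox k (u * v) = fox k u * v + augmentation n u • fox k v := by
  induction u using MonoidAlgebra.induction_linear with
  | zero => simp
  | add f g hf hg => simp only [add_mul, map_add, hf, hg, add_smul]; abel
  | single f c =>
    induction v using MonoidAlgebra.induction_linear with
    | zero => simp
    | add f g hf hg => simp only [mul_add, map_add, hf, hg, smul_add]; abel
    | single g d =>
      rw [MonoidAlgebra.single_mul_single, fox_single, fox_single, fox_single, foxGroup_mul]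
      have h1 : MonoidAlgebra.single g d = d • MonoidAlgebra.of ℤ _ g := by
        simp [MonoidAlgebra.smul_single]
      simp only [augmentation, MonoidAlgebra.lift_single, h1, MonoidHom.one_apply, smul_eq_mul,
        mul_one, smul_add, mul_smul, mul_smul_comm, smul_mul_assoc]
      rw [smul_comm c d]

/-- The free pro-`p` group with generators `x_0, …, x_{n-1}`: the pro-`p` completion of the free
group on these generators. -/
abbrev FreeProP (p n : ℕ) : Type := ProPCompletion p (FreeGroup (Fin n))

/-- The generator `x_j` of the free pro-`p` group. -/
def FreeProP.gen (p : ℕ) {n : ℕ} (j : Fin n) : FreeProP p n :=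
  ProPCompletion.eta p _ (FreeGroup.of j)

variable (p : ℕ) [Fact p.Prime]

/-- The canonical homomorphism `ℤ[F_n] → ℤ_p[[F(n)]]`. -/
def iota (n : ℕ) : MonoidAlgebra ℤ (FreeGroup (Fin n)) →ₐ[ℤ] CompletedGroupAlgebra p (FreeProP p n) :=
  MonoidAlgebra.lift ℤ _ _
    ((CompletedGroupAlgebra.of p).comp (ProPCompletion.eta p (FreeGroup (Fin n))))

variable {p}

instance finite_quotient (U : OpenNormalSubgroup (FreeProP p n)) :
    Finite (FreeProP p n ⧸ U.toSubgroup) := by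
  obtain ⟨k, hk⟩ := ProPCompletion.card_quotient U
  exact Nat.finite_of_card_ne_zero (by rw [hk]; exact pow_ne_zero _ (Fact.out : p.Prime).ne_zero)

instance : CompleteSpace (CompletedGroupAlgebra p (FreeProP p n)) :=
  CompletedGroupAlgebra.completeSpace fun U => finite_quotient U

open CompletedGroupAlgebra

theorem iota_single (f : FreeGroup (Fin n)) (c : ℤ) :
    iota p n (MonoidAlgebra.single f c) = c • of p (ProPCompletion.eta p _ f) := by
  simp [iota]

theorem red_of (U : OpenNormalSubgroup (FreeProP p n)) (m : ℕ) (g : FreeProP p n) :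
    red U m (of p g) = MonoidAlgebra.single (g : FreeProP p n ⧸ U.toSubgroup) 1 := by
  change MonoidAlgebra.mapRingHom _ _ (MonoidAlgebra.single _ 1) = _
  rw [MonoidAlgebra.mapRingHom_single, map_one]
  rfl

theorem red_iota_surjective (U : OpenNormalSubgroup (FreeProP p n)) (m : ℕ)
    (y : MonoidAlgebra (ZMod (p ^ m)) (FreeProP p n ⧸ U.toSubgroup)) :
    ∃ u, red U m (iota p n u) = y := by
  induction y using MonoidAlgebra.induction_linear with
  | zero => exact ⟨0, by simp⟩
  | add y z hy hz =>
    obtain ⟨u, rfl⟩ := hy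
    obtain ⟨v, rfl⟩ := hz
    exact ⟨u + v, by simp⟩
  | single q c =>
    obtain ⟨x, rfl⟩ := QuotientGroup.mk_surjective q
    obtain ⟨g, hg⟩ := ProPCompletion.exists_eta_mem U.isOpen' x
    obtain ⟨c, rfl⟩ := ZMod.intCast_surjective c
    refine ⟨MonoidAlgebra.single g c, ?_⟩
    rw [iota_single, map_zsmul, red_of, ← QuotientGroup.eq.2 hg, MonoidAlgebra.smul_single]
    simp

theorem denseRange_iota : DenseRange (iota p n) := fun a => by
  rw [mem_closure_iff_nhds_zero]
  intro W hW
  obtain ⟨U, m, h⟩ := exists_red_subset hW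
  obtain ⟨u, hu⟩ := red_iota_surjective U m (red U m a)
  exact ⟨iota p n u, ⟨u, rfl⟩, h _ (by rw [map_sub, hu, sub_self])⟩

/-- Modulo `p ^ m` and an open normal subgroup `U`, the Fox derivative only depends on the image
of its argument modulo `p ^ m` and a smaller open normal subgroup `V`. -/
theorem exists_red_fox (k : Fin n) (U : OpenNormalSubgroup (FreeProP p n)) (m : ℕ) :
    ∃ V : OpenNormalSubgroup (FreeProP p n), ∀ u,
      red V m (iota p n u) = 0 → red U m (iota p n (fox k u)) = 0 := by
  let A := MonoidAlgebra (ZMod (p ^ m)) (FreeProP p n ⧸ U.toSubgroup)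
  let e := ProPCompletion.eta p (FreeGroup (Fin n))
  let ρ : MonoidAlgebra ℤ (FreeGroup (Fin n)) →+* A := (red U m).comp (iota p n : _ →+* _)
  let d : FreeGroup (Fin n) → A := fun f => ρ (foxGroup k f)
  have hρ : ∀ f, ρ (MonoidAlgebra.of ℤ _ f) =
      MonoidAlgebra.of (ZMod (p ^ m)) _ (e f : FreeProP p n ⧸ U.toSubgroup) := fun f => by
    change red U m (iota p n (MonoidAlgebra.single f 1)) = _
    rw [iota_single, one_smul, red_of]
    rfl
  have hd : ∀ f g, d (f * g) = d f * ρ (MonoidAlgebra.of ℤ _ g) + d g := fun f g => by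
    simp only [d, foxGroup_mul, map_add, map_mul]
  have hd1 : d 1 = 0 := by simp [d, foxGroup_one]
  let U' : Subgroup (FreeGroup (Fin n)) := U.toSubgroup.comap e
  have hU' : ∀ f ∈ U', ρ (MonoidAlgebra.of ℤ _ f) = 1 := fun f hf => by
    have : (e f : FreeProP p n ⧸ U.toSubgroup) = 1 := (QuotientGroup.eq_one_iff _).2 hf
    rw [hρ, this, map_one]
  have hdU : ∀ f, ∀ g ∈ U', d (f * g) = d f + d g := fun f g hg => by
    rw [hd, hU' g hg, mul_one]
  let D : U' →* Multiplicative A :=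
    { toFun := fun f => Multiplicative.ofAdd (d f)
      map_one' := by simp [hd1]
      map_mul' := fun f g => by simp [hdU f g g.2] }
  let K : Subgroup (FreeGroup (Fin n)) := D.ker.map U'.subtype
  have hK : ∀ f, f ∈ K ↔ f ∈ U' ∧ d f = 0 := fun f => by
    constructor
    · rintro ⟨g, hg, rfl⟩
      exact ⟨g.2, hg⟩
    · rintro ⟨h1, h2⟩
      exact ⟨⟨f, h1⟩, h2, rfl⟩
  have hKn : K.Normal := ⟨fun f hf g => by
    obtain ⟨h1, h2⟩ := (hK f).1 hf
    refine (hK _).2 ⟨(inferInstance : U'.Normal).conj_mem f h1 g, ?_⟩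
    rw [hd (g * f), hdU g f h1, h2, add_zero, ← hd, mul_inv_cancel, hd1]⟩
  have hKi : ∃ l : ℕ, K.index = p ^ l := by
    obtain ⟨a, ha⟩ := ProPCompletion.card_quotient U
    have hU'i : U'.index = p ^ a := by
      have hs : Function.Surjective ((QuotientGroup.mk' U.toSubgroup).comp e) := fun q => by
        obtain ⟨x, rfl⟩ := QuotientGroup.mk_surjective q
        obtain ⟨g, hg⟩ := ProPCompletion.exists_eta_mem U.isOpen' x
        exact ⟨g, QuotientGroup.eq.2 hg⟩
      have hk : ((QuotientGroup.mk' U.toSubgroup).comp e).ker = U' := by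
        rw [← MonoidHom.comap_ker, QuotientGroup.ker_mk']
      rw [← hk, Subgroup.index_ker, MonoidHom.range_eq_top.2 hs, ← ha]
      exact Nat.card_congr Subgroup.topEquiv.toEquiv
    have hA : Nat.card (Multiplicative A) = p ^ (m * p ^ a) := by
      rw [Nat.card_congr (Multiplicative.toAdd.trans
        (MonoidAlgebra.coeffEquiv.trans Finsupp.equivFunOnFinite)), Nat.card_fun, ha,
        Nat.card_zmod, pow_mul]
    obtain ⟨b, -, hb⟩ := (Nat.dvd_prime_pow (Fact.out : p.Prime)).1
      (hA ▸ Subgroup.card_subgroup_dvd_card D.range)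
    refine ⟨b + a, ?_⟩
    have hle : K ≤ U' := fun f hf => ((hK f).1 hf).1
    have hsub : K.subgroupOf U' = D.ker := by
      ext f
      rw [Subgroup.mem_subgroupOf, hK]
      exact ⟨fun h => h.2, fun h => ⟨f.2, h⟩⟩
    rw [← Subgroup.relIndex_mul_index hle, Subgroup.relIndex, hsub, Subgroup.index_ker, hb, hU'i,
      pow_add]
  let N : PPowerNormal p (FreeGroup (Fin n)) := ⟨K, hKn, hKi⟩
  let V : OpenNormalSubgroup (FreeProP p n) :=
    { toOpenSubgroup := ⟨(ProPCompletion.proj N).ker, ProPCompletion.isOpen_ker_proj N⟩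
      isNormal' := MonoidHom.normal_ker _ }
  have hV : ∀ f g, (e f : FreeProP p n ⧸ V.toSubgroup) = e g → d f = d g := fun f g h => by
    have h1 : (e f)⁻¹ * e g ∈ (ProPCompletion.proj N).ker := QuotientGroup.eq.1 h
    have h2 : f⁻¹ * g ∈ K := by
      rw [← map_inv, ← map_mul] at h1
      exact (QuotientGroup.eq_one_iff (N := K) _).1 h1
    obtain ⟨h3, h4⟩ := (hK _).1 h2
    have := hdU f _ h3
    rwa [mul_inv_cancel_left, h4, add_zero, eq_comm] at this
  have hlift : ∀ q : FreeProP p n ⧸ V.toSubgroup, ∃ f, (e f : FreeProP p n ⧸ V.toSubgroup) = q :=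
    fun q => by
      obtain ⟨x, rfl⟩ := QuotientGroup.mk_surjective q
      obtain ⟨g, hg⟩ := ProPCompletion.exists_eta_mem V.isOpen' x
      exact ⟨g, QuotientGroup.eq.2 hg⟩
  choose s hs using hlift
  let Ψ : MonoidAlgebra (ZMod (p ^ m)) (FreeProP p n ⧸ V.toSubgroup) →ₗ[ZMod (p ^ m)] A :=
    Finsupp.linearCombination (ZMod (p ^ m)) (fun q => d (s q)) ∘ₗ
      (MonoidAlgebra.coeffLinearEquiv (ZMod (p ^ m))).toLinearMap
  have hΨ : ∀ q c, Ψ (MonoidAlgebra.single q c) = c • d (s q) := fun q c => by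
    change Finsupp.linearCombination _ _ (MonoidAlgebra.single q c).coeff = _
    rw [MonoidAlgebra.coeff_single, Finsupp.linearCombination_single]
  refine ⟨V, fun u hu => ?_⟩
  have key : Ψ (red V m (iota p n u)) = red U m (iota p n (fox k u)) := by
    clear hu
    induction u using MonoidAlgebra.induction_linear with
    | zero => simp
    | add f g hf hg => simp only [map_add, hf, hg]
    | single f c =>
      rw [iota_single, fox_single, map_zsmul, map_zsmul, map_zsmul, map_zsmul, red_of, hΨ, one_smul]
      exact congrArg (c • ·) (hV _ _ (hs _))
  rw [← key, hu, map_zero]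

theorem tendsto_iota_fox (k : Fin n) :
    Tendsto (fun u => iota p n (fox k u)) (comap (iota p n) (𝓝 0)) (𝓝 0) := by
  intro W hW
  obtain ⟨U, m, h⟩ := exists_red_subset hW
  obtain ⟨V, hV⟩ := exists_red_fox (p := p) k U m
  exact ⟨_, red_eq_zero_mem_nhds V m, fun u hu => h _ (hV u hu)⟩

variable (p) in
/-- The Fox derivative `∂_k` of `ℤ_p[[F(n)]]`: the extension by continuity of the Fox derivative
`D_k` of `ℤ[F_n]` along `ℤ[F_n] → ℤ_p[[F(n)]]`. That this is a well-defined continuous extension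
is `continuous_foxDeriv` and `foxDeriv_iota`. -/
def foxDeriv (k : Fin n) (a : CompletedGroupAlgebra p (FreeProP p n)) :
    CompletedGroupAlgebra p (FreeProP p n) :=
  limUnder (comap (iota p n) (𝓝 a)) fun u => iota p n (fox k u)

theorem foxDeriv_aux (k : Fin n) :
    Continuous (foxDeriv p k) ∧ ∀ u, foxDeriv p k (iota p n u) = iota p n (fox k u) := by
  let _ : UniformSpace (MonoidAlgebra ℤ (FreeGroup (Fin n))) :=
    UniformSpace.comap (iota p n) inferInstance
  have h_e : IsUniformInducing (iota p n) := ⟨rfl⟩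
  have : IsUniformAddGroup (MonoidAlgebra ℤ (FreeGroup (Fin n))) :=
    IsUniformAddGroup.comap (iota p n)
  let φ : MonoidAlgebra ℤ (FreeGroup (Fin n)) →+ CompletedGroupAlgebra p (FreeProP p n) :=
    (iota p n : _ →+ _).comp (fox k).toAddMonoidHom
  have h_f : UniformContinuous φ := by
    refine uniformContinuous_of_tendsto_zero ?_
    rw [h_e.isInducing.nhds_eq_comap, map_zero]
    exact tendsto_iota_fox k
  exact ⟨(uniformContinuous_uniformly_extend h_e denseRange_iota h_f).continuous,
    uniformly_extend_of_ind h_e denseRange_iota h_f⟩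

theorem continuous_foxDeriv (k : Fin n) : Continuous (foxDeriv p k) := (foxDeriv_aux k).1

theorem foxDeriv_iota (k : Fin n) (u : MonoidAlgebra ℤ (FreeGroup (Fin n))) :
    foxDeriv p k (iota p n u) = iota p n (fox k u) := (foxDeriv_aux k).2 u

end Fox

section Quotient

variable {G : Type*} [Group G] [TopologicalSpace G] [IsTopologicalGroup G]

/-- The closed normal subgroup generated by `r`. -/
def closedNormalClosure (r : G) : Subgroup G := (Subgroup.normalClosure {r}).topologicalClosure

instance (r : G) : (closedNormalClosure r).Normal := Subgroup.is_normal_topologicalClosure _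

/-- The closed subgroup (topologically) generated by a set. -/
def closedClosure (S : Set G) : Subgroup G := (Subgroup.closure S).topologicalClosure

/-- The natural homomorphism `G → G ⧸ N`, where `G ⧸ N` carries the quotient topology. -/
def quotientHom (N : Subgroup G) [N.Normal] : G →ₜ* G ⧸ N where
  toMonoidHom := QuotientGroup.mk' N
  continuous_toFun := continuous_quotient_mk'

end Quotient

end ProPFox

end

open Filter Topology
open scoped Pointwise

/-! The Fox derivative is read through functions on finite quotients. Let `Φ` be a locally constant
function on `F(n)` with values in `ℤ/p`, invariant under left multiplication by `x_1, …, x_{n-1}`,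
and suppose that `g ↦ Φ(x_n g) - Φ(g)` factors through `F(n)/N'`. Extend this difference linearly to
a functional `Λ` on `(ℤ/p)[F(n)/N']`. Telescoping along a word `f` gives `Λ(D_n f) = Φ(f) - Φ(1)`
(`exists_fox_functional`). If moreover `R ≤ N'`, then `π(∂_n r) = 0` forces `Λ(∂_n r) = 0`
(`proj_eq_zero_of_map_eq_zero`), so it suffices to find such a `Φ` with `Φ(r) ≠ Φ(1)`.

The hypothesis `H ∩ R = 1` yields an open normal `N` modulo which `r` becomes a central element `z`
with `z ^ p = 1`, outside the image `K` of `H` (`exists_central_quotient`). Since `K` then meets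
`⟨z⟩` trivially, some left `K`-invariant `φ` on `F(n)/N` satisfies `φ(g z^i) = φ(g) + i`
(`exists_invariant_function`). Take for `Φ` the pullback of `φ`. The shifts by `z` cancel in `Φ(x_n
g) - Φ(g)`, so this difference lives on the quotient by `N' = N⟨r⟩ ≥ R`, whereas `Φ(r) - Φ(1) = 1`.
Continuity of `∂_n` carries the telescoping formula from the discrete free group to `r`. -/

namespace ProPFox

/-! ### Finite group theory: isolating a central element, and functions shifted by it -/

section PGroup

variable {p : ℕ} [Fact p.Prime] {P : Type*} [Group P]

/-- A maximal normal subgroup among those avoiding a nontrivial element `x` of a finite `p`-group: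
modulo it, `x` is central of order `p`. -/
theorem exists_normal_notMem_of_isPGroup [Finite P] (hP : IsPGroup p P) {x : P} (hx : x ≠ 1) :
    ∃ L : Subgroup P, L.Normal ∧ x ∉ L ∧ x ^ p ∈ L ∧ ∀ g, g * x * g⁻¹ * x⁻¹ ∈ L := by
  obtain ⟨L, hL⟩ := (Set.toFinite {L : Subgroup P | L.Normal ∧ x ∉ L}).exists_maximal
    ⟨⊥, inferInstance, by simpa using hx⟩
  have hn : L.Normal := hL.1.1
  have hxL : x ∉ L := hL.1.2
  have hne : (x : P ⧸ L) ≠ 1 := fun h => hxL ((QuotientGroup.eq_one_iff x).1 h)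
  have : Nontrivial (P ⧸ L) := ⟨⟨_, _, hne⟩⟩
  have hQ : IsPGroup p (P ⧸ L) := hP.to_quotient L
  have hc : Nontrivial (Subgroup.center (P ⧸ L)) := hQ.center_nontrivial
  have hpc : IsPGroup p (Subgroup.center (P ⧸ L)) := hQ.to_subgroup _
  have hdvd : p ∣ Nat.card (Subgroup.center (P ⧸ L)) := by
    obtain ⟨k, hk, hk'⟩ := hpc.nontrivial_iff_card.1 hc
    rw [hk']
    exact dvd_pow_self p hk.ne'
  -- The centre of a nontrivial finite `p`-group contains an element `c` of order `p`; by maximality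
  -- of `L`, the class of `x` must be a power of it.
  obtain ⟨c, hc⟩ := exists_prime_orderOf_dvd_card' p hdvd
  have hcc : ∀ g, g * (c : P ⧸ L) = c * g := fun g => (Subgroup.mem_center_iff.1 c.2 g)
  have hc1 : (c : P ⧸ L) ≠ 1 := fun h => by
    have : c = 1 := Subtype.ext h
    rw [this, orderOf_one] at hc
    exact (Fact.out : p.Prime).one_lt.ne hc
  have hcp : (c : P ⧸ L) ^ p = 1 := by
    rw [← hc]
    exact congrArg Subtype.val (pow_orderOf_eq_one c)
  let Z : Subgroup (P ⧸ L) := Subgroup.zpowers (c : P ⧸ L)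
  have hZ : Z.Normal := ⟨by
    rintro _ ⟨i, rfl⟩ g
    refine ⟨i, ?_⟩
    have : Commute g ((c : P ⧸ L) ^ i) := Commute.zpow_right (hcc g) i
    change (c : P ⧸ L) ^ i = g * (c : P ⧸ L) ^ i * g⁻¹
    rw [this.eq, mul_inv_cancel_right]⟩
  have hxZ : (x : P ⧸ L) ∈ Z := by
    -- Otherwise the preimage of `⟨c⟩` is a normal subgroup avoiding `x`, and it is strictly larger
    -- than `L` because `c ≠ 1`.
    by_contra h
    have hle : L ≤ Z.comap (QuotientGroup.mk' L) := fun y hy => by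
      rw [Subgroup.mem_comap, QuotientGroup.mk'_apply, (QuotientGroup.eq_one_iff y).2 hy]
      exact one_mem _
    have hle' := hL.2 (⟨hZ.comap (QuotientGroup.mk' L), h⟩ :
      Z.comap (QuotientGroup.mk' L) ∈ {L : Subgroup P | L.Normal ∧ x ∉ L}) hle
    obtain ⟨y, hy⟩ := QuotientGroup.mk_surjective (c : P ⧸ L)
    have : y ∈ L := hle' (show (y : P ⧸ L) ∈ Z from hy ▸ Subgroup.mem_zpowers _)
    exact hc1 (hy ▸ (QuotientGroup.eq_one_iff y).2 this)
  obtain ⟨i, hi⟩ := hxZ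
  have hi : (c : P ⧸ L) ^ i = x := hi
  refine ⟨L, hn, hxL, ?_, fun g => ?_⟩
  · rw [← QuotientGroup.eq_one_iff, QuotientGroup.mk_pow, ← hi, ← zpow_natCast, zpow_comm,
      zpow_natCast, hcp, one_zpow]
  · rw [← QuotientGroup.eq_one_iff]
    simp only [QuotientGroup.mk_mul, QuotientGroup.mk_inv]
    have : Commute (g : P ⧸ L) ((c : P ⧸ L) ^ i) := Commute.zpow_right (hcc _) i
    rw [← hi, this.eq, mul_inv_cancel_right, mul_inv_cancel]

/-- If `z` is central of order `p` and `K` is a subgroup not containing `z`, there is a left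
`K`-invariant function to `ℤ/p` on which multiplication by `z` acts as adding `1`. -/
theorem exists_invariant_function {m : ℕ} (hm : m.Prime) {z : P} (hz : ∀ g, g * z = z * g)
    (hzm : z ^ m = 1)
    {K : Subgroup P} (hzK : z ∉ K) :
    ∃ φ : P → ZMod m, (∀ k ∈ K, ∀ g, φ (k * g) = φ g) ∧
      ∀ (g : P) (i : ℤ), φ (g * z ^ i) = φ g + i := by
  have hcomm : ∀ (g : P) (i : ℤ), g * z ^ i = z ^ i * g := fun g i =>
    (Commute.zpow_right (hz g : Commute g z) i).eq
  have hzi : ∀ i : ℤ, z ^ i ∈ K → (i : ZMod m) = 0 := fun i hi => by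
    by_contra h
    rw [ZMod.intCast_zmod_eq_zero_iff_dvd] at h
    -- For `i` prime to `m`, Bézout makes `z` a power of `z ^ i`, which would put `z` in `K`.
    have hcop : IsCoprime i (m : ℤ) :=
      ((Nat.prime_iff_prime_int.1 hm).coprime_iff_not_dvd.2 h).symm
    obtain ⟨a, b, hab⟩ := hcop
    apply hzK
    have : z = (z ^ i) ^ a := by
      rw [← zpow_mul]
      conv_lhs => rw [← zpow_one z, ← hab, zpow_add, mul_comm b, zpow_mul z m b, zpow_natCast, hzm,
        one_zpow, mul_one, mul_comm a]
    rw [this]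
    exact zpow_mem hi a
  -- The classes are the double cosets `K g ⟨z⟩`. Fix a representative in each; `φ(g)` will be the
  -- exponent of `z` needed to reach `g` from it, modulo `m`.
  let S : Setoid P :=
    { r := fun g g' => ∃ k ∈ K, ∃ i : ℤ, g' = k * g * z ^ i
      iseqv :=
        { refl := fun g => ⟨1, one_mem _, 0, by simp⟩
          symm := by
            rintro g _ ⟨k, hk, i, rfl⟩
            refine ⟨k⁻¹, inv_mem hk, -i, ?_⟩
            rw [mul_assoc k, inv_mul_cancel_left, mul_assoc, ← zpow_add, add_neg_cancel, zpow_zero,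
              mul_one]
          trans := by
            rintro g _ _ ⟨k, hk, i, rfl⟩ ⟨l, hl, j, rfl⟩
            refine ⟨l * k, mul_mem hl hk, i + j, ?_⟩
            simp only [zpow_add, mul_assoc] } }
  have hout : ∀ g : P, ∃ i : ℤ, ∃ k ∈ K, g = k * (Quotient.mk S g).out * z ^ i := fun g => by
    obtain ⟨k, hk, i, h⟩ := Quotient.exact (Quotient.out_eq (Quotient.mk S g))
    exact ⟨i, k, hk, h⟩
  choose e he using hout
  have huniq : ∀ (g : P) (i : ℤ), ∀ k ∈ K, g = k * (Quotient.mk S g).out * z ^ i →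
      (e g : ZMod m) = i := fun g i k hk h => by
    obtain ⟨l, hl, h'⟩ := he g
    have h1 : k * (Quotient.mk S g).out * z ^ i = l * (Quotient.mk S g).out * z ^ e g :=
      h.symm.trans h'
    -- Centrality moves the powers of `z` past the representative, which then cancels; two exponents
    -- thus differ by a power of `z` lying in `K`.
    have h2 : z ^ (e g - i) = l⁻¹ * k := by
      rw [hcomm, hcomm, ← mul_assoc, ← mul_assoc] at h1
      have h3 := mul_right_cancel h1
      rw [← hcomm, ← hcomm] at h3
      rw [zpow_sub, eq_inv_mul_iff_mul_eq, ← mul_assoc, ← h3, mul_inv_cancel_right]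
    have := hzi _ (h2 ▸ mul_mem (inv_mem hl) hk)
    push_cast at this
    exact sub_eq_zero.1 this
  refine ⟨fun g => e g, fun k hk g => ?_, fun g i => ?_⟩
  · obtain ⟨l, hl, h⟩ := he g
    have hq : Quotient.mk S (k * g) = Quotient.mk S g :=
      (Quotient.sound (⟨k, hk, 0, by simp⟩ : S.r g (k * g))).symm
    refine huniq (k * g) (e g) (k * l) (mul_mem hk hl) ?_
    rw [hq]
    conv_lhs => rw [h]
    simp only [mul_assoc]
  · obtain ⟨l, hl, h⟩ := he g
    have hq : Quotient.mk S (g * z ^ i) = Quotient.mk S g :=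
      (Quotient.sound (⟨1, one_mem _, i, by simp⟩ : S.r g (g * z ^ i))).symm
    have := huniq (g * z ^ i) (e g + i) l hl (by
      rw [hq, zpow_add, ← mul_assoc, ← h])
    simpa using this

end PGroup

/-! ### Topology of the free pro-`p` group and its finite quotients -/

section FreeProP

variable {p : ℕ} [Fact p.Prime] {n : ℕ}

open CompletedGroupAlgebra

theorem isPGroup_quotient (U : OpenNormalSubgroup (FreeProP p n)) :
    IsPGroup p (FreeProP p n ⧸ U.toSubgroup) := IsPGroup.iff_card.2 (ProPCompletion.card_quotient U)

theorem exists_openNormalSubgroup_subset {W : Set (FreeProP p n)} (hW : W ∈ 𝓝 1) :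
    ∃ U : OpenNormalSubgroup (FreeProP p n), (U : Set (FreeProP p n)) ⊆ W := by
  obtain ⟨N, hN⟩ := ProPCompletion.exists_ker_subset hW
  exact ⟨{ toOpenSubgroup := ⟨(ProPCompletion.proj N).ker, ProPCompletion.isOpen_ker_proj N⟩
           isNormal' := MonoidHom.normal_ker _ }, hN⟩

/-- Needed so that points, and products of compact subgroups, are closed. -/
instance : T2Space (FreeProP p n) := by
  let _ : ∀ N : PPowerNormal p (FreeGroup (Fin n)), TopologicalSpace (FreeGroup (Fin n) ⧸ N.1) :=
    fun _ => ⊥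
  have : ∀ N : PPowerNormal p (FreeGroup (Fin n)), DiscreteTopology (FreeGroup (Fin n) ⧸ N.1) :=
    fun _ => ⟨rfl⟩
  exact inferInstanceAs (T2Space (proPSubgroup p (FreeGroup (Fin n))))

/-- Each coefficient at level `U` depends only on the class of the group element modulo `U`, hence
is locally constant. -/
theorem continuous_of : Continuous (of p : FreeProP p n → CompletedGroupAlgebra p (FreeProP p n)) := by
  refine isUniformInducing_coeffs.isInducing.continuous_iff.2 ?_
  refine continuous_pi fun U => continuous_pi fun q => ?_
  have : DiscreteTopology (FreeProP p n ⧸ U.toSubgroup) :=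
    QuotientGroup.discreteTopology U.isOpen'
  exact (continuous_of_discreteTopology (f := fun x : FreeProP p n ⧸ U.toSubgroup =>
    (MonoidAlgebra.of ℤ_[p] _ x).coeff q)).comp continuous_quotient_mk'

/-- If a closed subgroup `H` meets the closed normal subgroup `R` generated by `r` trivially, then
in some finite quotient `r` becomes a central element of order `p` outside the image of `H`. -/
theorem exists_central_quotient {r : FreeProP p n} (hr : r ≠ 1) {H : Subgroup (FreeProP p n)}
    (hH : IsClosed (H : Set (FreeProP p n))) (hHR : H ⊓ closedNormalClosure r = ⊥) :
    ∃ N : OpenNormalSubgroup (FreeProP p n), r ^ p ∈ N.toSubgroup ∧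
      (∀ g, g * r * g⁻¹ * r⁻¹ ∈ N.toSubgroup) ∧ ∀ h ∈ H, h⁻¹ * r ∉ N.toSubgroup := by
  have hrR : r ∈ closedNormalClosure r :=
    Subgroup.le_topologicalClosure _ (Subgroup.subset_normalClosure rfl)
  have hRn : (closedNormalClosure r).Normal := inferInstance
  have hRc : IsClosed (closedNormalClosure r : Set (FreeProP p n)) :=
    Subgroup.isClosed_topologicalClosure _
  obtain ⟨U, hU⟩ := exists_openNormalSubgroup_subset (W := {r}ᶜ)
    (isClosed_singleton.isOpen_compl.mem_nhds (by simpa using hr.symm))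
  have hrU : (r : FreeProP p n ⧸ U.toSubgroup) ≠ 1 := fun h =>
    hU ((QuotientGroup.eq_one_iff r).1 h) rfl
  obtain ⟨L', hL'n, hL'1, hL'2, hL'3⟩ := exists_normal_notMem_of_isPGroup (isPGroup_quotient U) hrU
  let L : Subgroup (FreeProP p n) := L'.comap (QuotientGroup.mk' U.toSubgroup)
  have hLn : L.Normal := hL'n.comap _
  have hLo : IsOpen (L : Set (FreeProP p n)) := Subgroup.isOpen_mono (H₁ := U.toSubgroup)
    (fun x hx => by
      rw [Subgroup.mem_comap, QuotientGroup.mk'_apply, (QuotientGroup.eq_one_iff x).2 hx]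
      exact one_mem _) U.isOpen'
  -- Intersecting with `R` loses nothing, since `r ^ p` and the commutators of `r` lie in `R`
  -- already. It is what lets `H ∩ R = 1` be used: if `r = h m` with `m ∈ M`, then `h ∈ H ∩ R`, so
  -- `h = 1` and `r ∈ L`.
  let M : Subgroup (FreeProP p n) := closedNormalClosure r ⊓ L
  have hMc : IsClosed (M : Set (FreeProP p n)) := hRc.inter (L.isClosed_of_isOpen hLo)
  have hHM : IsClosed ((H : Set (FreeProP p n)) * (M : Set (FreeProP p n))) :=
    (hH.isCompact.mul hMc.isCompact).isClosed
  have hrHM : r ∉ (H : Set (FreeProP p n)) * (M : Set (FreeProP p n)) := by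
    rintro ⟨h, hh, m, hm, hhm⟩
    have hhm : h * m = r := hhm
    have h1 : h ∈ H ⊓ closedNormalClosure r :=
      ⟨hh, by
        rw [eq_mul_inv_of_mul_eq hhm]
        exact (closedNormalClosure r).mul_mem hrR ((closedNormalClosure r).inv_mem hm.1)⟩
    rw [hHR, Subgroup.mem_bot] at h1
    rw [h1, one_mul] at hhm
    exact hL'1 (hhm ▸ hm.2)
  -- `M` need not be open. As `H M` is closed and misses `r`, a whole coset `r U'` misses it, so `M`
  -- can be enlarged to the open subgroup `M U'` with `r` still outside `H M U'`.
  obtain ⟨U', hU'⟩ := exists_openNormalSubgroup_subset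
    (W := (fun x => r * x) ⁻¹' ((H : Set (FreeProP p n)) * (M : Set (FreeProP p n)))ᶜ)
    ((hHM.isOpen_compl.preimage (continuous_const_mul r)).mem_nhds (by simpa using hrHM))
  have hMn : M.Normal := inferInstanceAs (closedNormalClosure r ⊓ L).Normal
  have hU'n : U'.toSubgroup.Normal := U'.isNormal'
  refine ⟨{ toOpenSubgroup := ⟨M ⊔ U'.toSubgroup, Subgroup.isOpen_mono le_sup_right U'.isOpen'⟩
            isNormal' := Subgroup.sup_normal M U'.toSubgroup }, ?_, fun g => ?_, fun h hh hmem => ?_⟩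
  · exact (le_sup_left : M ≤ _) ⟨(closedNormalClosure r).pow_mem hrR p, hL'2⟩
  · exact (le_sup_left : M ≤ _)
      ⟨(closedNormalClosure r).mul_mem (hRn.conj_mem r hrR g) ((closedNormalClosure r).inv_mem hrR),
        hL'3 (g : FreeProP p n ⧸ U.toSubgroup)⟩
  · have hmem : h⁻¹ * r ∈ M ⊔ U'.toSubgroup := hmem
    obtain ⟨m, hm, u, hu, hmu⟩ := Subgroup.mem_sup_of_normal_right.1 hmem
    have hru : h * m = r * u⁻¹ := by
      rw [eq_mul_inv_iff_mul_eq, mul_assoc, hmu, mul_inv_cancel_left]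
    exact hU' (U'.toSubgroup.inv_mem hu) ⟨h, hh, m, hm, hru⟩

/-! ### Fox derivatives as differences of functions, and the kernel of `π` -/

/-- A function `Φ` on the group whose differences `Φ (x_k g) - Φ g` are given by a function `α`
on a finite quotient, and which is invariant under left multiplication by the other generators, is
recovered from `α` by the Fox derivative with respect to `x_k`. -/
theorem exists_fox_functional (k : Fin n) (N : OpenNormalSubgroup (FreeProP p n)) (m : ℕ)
    (Φ : FreeProP p n → ZMod (p ^ m)) (α : FreeProP p n ⧸ N.toSubgroup → ZMod (p ^ m))
    (hα : ∀ g : FreeProP p n, α g = Φ (FreeProP.gen p k * g) - Φ g)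
    (hΦ : ∀ j ≠ k, ∀ g, Φ (FreeProP.gen p j * g) = Φ g) :
    ∃ Λ : MonoidAlgebra (ZMod (p ^ m)) (FreeProP p n ⧸ N.toSubgroup) →+ ZMod (p ^ m),
      ∀ f, Λ (red N m (iota p n (foxGroup k f))) =
        Φ (ProPCompletion.eta p _ f) - Φ 1 := by
  let e := ProPCompletion.eta p (FreeGroup (Fin n))
  let Λ : MonoidAlgebra (ZMod (p ^ m)) (FreeProP p n ⧸ N.toSubgroup) →ₗ[ZMod (p ^ m)] ZMod (p ^ m) :=
    Finsupp.linearCombination (ZMod (p ^ m)) α ∘ₗ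
      (MonoidAlgebra.coeffLinearEquiv (ZMod (p ^ m))).toLinearMap
  have hΛ : ∀ q, Λ (MonoidAlgebra.single q 1) = α q := fun q => by
    change Finsupp.linearCombination _ _ (MonoidAlgebra.single q (1 : ZMod (p ^ m))).coeff = _
    rw [MonoidAlgebra.coeff_single, Finsupp.linearCombination_single, one_smul]
  let T : MonoidAlgebra ℤ (FreeGroup (Fin n)) →+ ZMod (p ^ m) :=
    Λ.toAddMonoidHom.comp ((red N m).toAddMonoidHom.comp (iota p n).toRingHom.toAddMonoidHom)
  have hT : ∀ v, T (MonoidAlgebra.of ℤ _ v) = α (e v) := fun v => by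
    change Λ (red N m (iota p n (MonoidAlgebra.single v 1))) = _
    rw [iota_single, one_smul, red_of, hΛ]
  -- The right factor `v` makes the induction close: in `D(ab)v = D(a)bv + D(b)v` the two
  -- differences telescope.
  have key : ∀ u v, T (foxGroup k u * MonoidAlgebra.of ℤ _ v) = Φ (e (u * v)) - Φ (e v) := by
    intro u
    induction u using FreeGroup.induction_on with
    | C1 => intro v; simp [foxGroup_one]
    | of j =>
      intro v
      rw [foxGroup_of]
      by_cases h : j = k
      · subst h
        rw [if_pos rfl, one_mul, hT, hα, map_mul]
        rfl
      · rw [if_neg h, zero_mul, map_zero, map_mul, eq_comm, sub_eq_zero]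
        exact hΦ j h _
    | inv_of j ih =>
      intro v
      have h1 : foxGroup k (FreeGroup.of j)⁻¹ =
          -(foxGroup k (FreeGroup.of j) * MonoidAlgebra.of ℤ _ (FreeGroup.of j)⁻¹) := by
        rw [eq_neg_iff_add_eq_zero, add_comm, ← foxGroup_mul, mul_inv_cancel, foxGroup_one]
      rw [h1, neg_mul, mul_assoc, ← map_mul, map_neg, ih, mul_inv_cancel_left, neg_sub]
    | mul a b ha hb =>
      intro v
      rw [foxGroup_mul, add_mul, mul_assoc, ← map_mul, map_add, ha, hb, mul_assoc]
      ring
  refine ⟨Λ.toAddMonoidHom, fun f => ?_⟩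
  have := key f 1
  rwa [map_one, mul_one, mul_one, map_one] at this

/-- If `π(a) = 0` then the components of `a` at the open normal subgroups containing `R` vanish. -/
theorem proj_eq_zero_of_map_eq_zero {R : Subgroup (FreeProP p n)} [R.Normal]
    {a : CompletedGroupAlgebra p (FreeProP p n)}
    (ha : CompletedGroupAlgebra.map p (quotientHom R) a = 0)
    (N : OpenNormalSubgroup (FreeProP p n)) (hN : R ≤ N.toSubgroup) :
    CompletedGroupAlgebra.proj p N a = 0 := by
  have hNn : N.toSubgroup.Normal := N.isNormal'
  let V : OpenNormalSubgroup (FreeProP p n ⧸ R) :=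
    { toOpenSubgroup := ⟨N.toSubgroup.map (QuotientGroup.mk' R),
        QuotientGroup.isOpenMap_coe _ N.isOpen'⟩
      isNormal' := hNn.map _ (QuotientGroup.mk'_surjective R) }
  have hV : comapOpenNormal (quotientHom R) V = N := by
    have : (comapOpenNormal (quotientHom R) V).toSubgroup = N.toSubgroup := by
      change (N.toSubgroup.map (QuotientGroup.mk' R)).comap (QuotientGroup.mk' R) = _
      rw [Subgroup.comap_map_eq, QuotientGroup.ker_mk', sup_eq_left.2 hN]
    exact OpenNormalSubgroup.toSubgroup_injective this
  rw [← hV]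
  have h1 : MonoidAlgebra.mapDomainAlgHom ℤ_[p] ℤ_[p]
      (QuotientGroup.map (comapOpenNormal (quotientHom R) V).toSubgroup V.toSubgroup
        (quotientHom R : FreeProP p n →* FreeProP p n ⧸ R) le_rfl)
      (CompletedGroupAlgebra.proj p (comapOpenNormal (quotientHom R) V) a) = 0 :=
    congrFun (congrArg Subtype.val ha) V
  -- The source is the quotient by the full preimage of `V`, so no component is lost under `π`.
  have hinj : Function.Injective (QuotientGroup.map (comapOpenNormal (quotientHom R) V).toSubgroup
      V.toSubgroup (quotientHom R : FreeProP p n →* FreeProP p n ⧸ R) le_rfl) := by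
    rw [injective_iff_map_eq_one]
    intro q hq
    obtain ⟨x, rfl⟩ := QuotientGroup.mk_surjective q
    exact (QuotientGroup.eq_one_iff x).2
      ((QuotientGroup.eq_one_iff (N := V.toSubgroup) (quotientHom R x)).1 hq)
  exact MonoidAlgebra.mapDomain_injective hinj (h1.trans (by simp))

end FreeProP

end ProPFox

/-! ### The nonvanishing theorem -/

theorem mainTheorem3 (p : ℕ) [Fact p.Prime] (n : ℕ)
    (r : ProPFox.FreeProP p (n + 1)) (hr : r ≠ 1)
    (hHR : ProPFox.closedClosure
        (Set.range fun i : Fin n => ProPFox.FreeProP.gen p (Fin.castSucc i)) ⊓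
      ProPFox.closedNormalClosure r = ⊥) :
    ProPFox.CompletedGroupAlgebra.map p
        (ProPFox.quotientHom (ProPFox.closedNormalClosure r))
        (ProPFox.foxDeriv p (Fin.last n) (ProPFox.CompletedGroupAlgebra.of p r)) ≠ 0 := by
  open ProPFox CompletedGroupAlgebra in
  intro h0
  obtain ⟨N, hN1, hN2, hN3⟩ := exists_central_quotient hr
    (Subgroup.isClosed_topologicalClosure _) hHR
  have hNn : N.toSubgroup.Normal := N.isNormal'
  let q := QuotientGroup.mk' N.toSubgroup
  have hzc : ∀ g, g * q r = q r * g := fun g => by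
    obtain ⟨g, rfl⟩ := QuotientGroup.mk'_surjective _ g
    have : q (g * r * g⁻¹ * r⁻¹) = 1 := (QuotientGroup.eq_one_iff _).2 (hN2 g)
    rwa [map_mul, map_mul, map_mul, map_inv, map_inv, mul_inv_eq_one, mul_inv_eq_iff_eq_mul] at this
  -- The exponent is written `p ^ 1` so that the values of `φ` lie in the coefficient ring `ZMod (p
  -- ^ m)` of `red`, with `m = 1`.
  have hzp : q r ^ p ^ 1 = 1 := by
    rw [pow_one, ← map_pow]
    exact (QuotientGroup.eq_one_iff _).2 hN1
  have hzK : q r ∉ (closedClosure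
      (Set.range fun i : Fin n => FreeProP.gen p (Fin.castSucc i))).map q := by
    rintro ⟨h, hh, hhr⟩
    exact hN3 h hh (QuotientGroup.eq.1 hhr)
  have hp1 : (p ^ 1).Prime := by rw [pow_one]; exact Fact.out
  obtain ⟨φ, hφ1, hφ2⟩ := exists_invariant_function hp1 hzc hzp hzK
  have hZn : (Subgroup.zpowers (q r)).Normal := ⟨by
    rintro _ ⟨i, rfl⟩ g
    refine ⟨i, ?_⟩
    have : Commute g (q r ^ i) := Commute.zpow_right (hzc g) i
    change q r ^ i = g * q r ^ i * g⁻¹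
    rw [this.eq, mul_inv_cancel_right]⟩
  -- This is `N⟨r⟩`: it contains `R`, so vanishing of `π(∂_n r)` is visible modulo `N'`, though `Φ`
  -- itself is only defined modulo `N`.
  let N' : OpenNormalSubgroup (FreeProP p (n + 1)) :=
    { toOpenSubgroup := ⟨(Subgroup.zpowers (q r)).comap q, Subgroup.isOpen_mono
        (H₁ := N.toSubgroup) (fun x hx => by
          have : q x = 1 := (QuotientGroup.eq_one_iff x).2 hx
          rw [Subgroup.mem_comap, this]
          exact one_mem _) N.isOpen'⟩
      isNormal' := hZn.comap q }
  have hN'n : N'.toSubgroup.Normal := N'.isNormal'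
  have hRN' : closedNormalClosure r ≤ N'.toSubgroup :=
    Subgroup.topologicalClosure_minimal _
      (Subgroup.normalClosure_le_normal (Set.singleton_subset_iff.2 (Subgroup.mem_zpowers (q r))))
      (N'.toSubgroup.isClosed_of_isOpen N'.isOpen')
  let x := FreeProP.gen p (Fin.last n)
  let α : FreeProP p (n + 1) ⧸ N'.toSubgroup → ZMod (p ^ 1) := fun y =>
    φ (q (x * y.out)) - φ (q y.out)
  -- Changing the representative modulo `N'` multiplies its image by some `z ^ i`, which adds `i` to
  -- both terms.
  have hα : ∀ g : FreeProP p (n + 1), α g = φ (q (x * g)) - φ (q g) := fun g => by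
    obtain ⟨s, hs⟩ := QuotientGroup.mk_out_eq_mul N'.toSubgroup g
    obtain ⟨i, hi⟩ := s.2
    have hi : q r ^ i = q s := hi
    simp only [α, hs]
    rw [← mul_assoc, map_mul q _ (s : FreeProP p (n + 1)), map_mul q g (s : FreeProP p (n + 1)),
      ← hi, hφ2, hφ2]
    ring
  obtain ⟨Λ, hΛ⟩ := exists_fox_functional (Fin.last n) N' 1 (fun g => φ (q g)) α hα (by
    intro j hj g
    obtain ⟨i, rfl⟩ := Fin.exists_castSucc_eq.2 hj
    rw [map_mul]
    exact hφ1 _ (Subgroup.mem_map_of_mem q (Subgroup.le_topologicalClosure _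
      (Subgroup.subset_closure ⟨i, rfl⟩))) _)
  have hred : red N' 1 (foxDeriv p (Fin.last n) (of p r)) = 0 := by
    rw [red, RingHom.comp_apply]
    exact (congrArg _ (proj_eq_zero_of_map_eq_zero h0 N' hRN')).trans (map_zero _)
  -- The functional formula is known only on the discrete free group. Replace `r` by a word `f` so
  -- close to it that neither the derivative modulo `(p, N')` nor the class modulo `N` changes.
  have hc : Continuous fun g : FreeProP p (n + 1) => foxDeriv p (Fin.last n) (of p (r * g)) -
      foxDeriv p (Fin.last n) (of p r) :=
    ((continuous_foxDeriv _).comp (continuous_of.comp (continuous_const_mul r))).sub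
      continuous_const
  obtain ⟨U, hU⟩ := exists_openNormalSubgroup_subset (Filter.inter_mem
    (hc.continuousAt.preimage_mem_nhds (t := {a | red N' 1 a = 0}) (by
      have := finite_quotient N'
      simpa using red_eq_zero_mem_nhds (p := p) N' 1)) (N.isOpen'.mem_nhds N.toSubgroup.one_mem))
  obtain ⟨f, hf⟩ := ProPCompletion.exists_eta_mem U.isOpen' r
  obtain ⟨hf1, hf2⟩ := hU (inv_mem hf)
  have hrf : r * ((ProPCompletion.eta p _ f)⁻¹ * r)⁻¹ = ProPCompletion.eta p _ f := by group
  have hfox : foxDeriv p (Fin.last n) (of p (ProPCompletion.eta p _ f)) =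
      iota p (n + 1) (foxGroup (Fin.last n) f) := by
    have := foxDeriv_iota (p := p) (Fin.last n) (MonoidAlgebra.single f 1)
    rwa [iota_single, fox_single, one_smul, one_smul] at this
  have hf1 : red N' 1 (foxDeriv p (Fin.last n)
      (of p (r * ((ProPCompletion.eta p _ f)⁻¹ * r)⁻¹)) -
      foxDeriv p (Fin.last n) (of p r)) = 0 := hf1
  rw [map_sub, hred, sub_zero, hrf, hfox] at hf1
  have hqf : q (ProPCompletion.eta p _ f) = q r := by
    have h1 : q ((ProPCompletion.eta p _ f)⁻¹ * r)⁻¹ = 1 := (QuotientGroup.eq_one_iff _).2 hf2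
    rw [← hrf, map_mul, h1, mul_one]
  have h1 := hΛ f
  -- Writing `z` as `1 * z ^ 1` exposes the shift: the formula becomes `0 = (φ 1 + 1) - φ 1` in
  -- `ℤ/p`.
  rw [hf1, map_zero, hqf, map_one, ← one_mul (q r), ← zpow_one (q r), hφ2] at h1
  have : Fact (1 < p ^ 1) := ⟨hp1.one_lt⟩
  simp at h1
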